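/- Let $\mathbb F_q$ be a finite field and $G$ a finite group with $\gcd(|G|,q)=1$. Identify the group algebra $\mathbb F_q[G]$ with $\mathbb F_q^{|G|}$ through coefficients, with the Euclidean inner product $\langle \sum_g a_g g,\sum_g b_g g\rangle=\sum_g a_g b_g$. A group code is a two-sided ideal $C$ of $\mathbb F_q[G]$; its hull is $h(C)=C\cap C^\perp$, where $C^\perp=\{v\in\mathbb F_q[G] : \langle v,u\rangle=0 \text{ for all } u\in C\}$. Write the abelianization of $G$ as $$G^{ab}\cong \mathbb Z/n_1\mathbb Z\oplus\dots\oplus\mathbb Z/n_r\mathbb Z,\qquad 1<n_1\mid n_2\mid\cdots\mid n_r,$$ with $r \ge 0$ and the convention $n_i=1$ for $i\le 0$, and let $(a,b)$ denote the greatest common divisor. Then there exists a group code $C$ in $\mathbb F_q[G]$ with $\dim_{\mathbb F_q}h(C)=3$ if and only if at least one of the following conditions holds: 1. $(n_r,q-1)\ge 7$; 2. $5\le (n_r,q-1)\le 6$ and $(n_{r-1},q-1)\ge 2$; 3. $3\le (n_r,q-1)\le 4$ and $(n_{r-1},q-1)\ge 3$; 4. $3\le (n_r,q-1)\le 4$ and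 $(n_{r-1},q-1)=(n_{r-2},q-1)=2$; 5. $(n_r,q^2-1)>(n_r,q-1)\ge 3$ and $(n_r,q^2-1)>(n_r,q+1)$; 6. $(n_r,q^3-1)>(n_r,q-1)$. -/

import Mathlib

/-- The Euclidean inner product on `F[G]`, where `F[G]` is identified with `F ^ |G|` through the
coefficients with respect to the basis `G`. -/
noncomputable def groupAlgebraInner {F G : Type*} [Field F] [Fintype G] (u v : MonoidAlgebra F G) : F :=
  ∑ g : G, u.coeff g * v.coeff g

/-- The dual code `C^⊥ = {v | ⟨v, u⟩ = 0 for all u ∈ C}` of a linear code `C ⊆ F[G]`. -/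
noncomputable def dualCode {F G : Type*} [Field F] [Fintype G] (C : Submodule F (MonoidAlgebra F G)) :
    Submodule F (MonoidAlgebra F G) where
  carrier := {v | ∀ u ∈ C, groupAlgebraInner v u = 0}
  add_mem' := by
    intro a b ha hb u hu
    have h1 := ha u hu
    have h2 := hb u hu
    simp only [groupAlgebraInner] at h1 h2 ⊢
    simp [add_mul, Finset.sum_add_distrib, h1, h2]
  zero_mem' := by
    intro u _
    simp [groupAlgebraInner]
  smul_mem' := by
    intro c a ha u hu
    have h1 := ha u hu
    simp only [groupAlgebraInner] at h1 ⊢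
    simp [mul_assoc, ← Finset.mul_sum, h1]

/-- The hull `h(C) = C ∩ C^⊥` of a linear code `C ⊆ F[G]`. -/
noncomputable def codeHull {F G : Type*} [Field F] [Fintype G] (C : Submodule F (MonoidAlgebra F G)) :
    Submodule F (MonoidAlgebra F G) :=
  C ⊓ dualCode C

/-- For `n = (n_1, …, n_r)`, the number `n_{r-k}`, with the convention that `n_i = 1` for
`i ≤ 0` (a missing invariant factor corresponds to a trivial cyclic summand). -/
def factorFromTop {r : ℕ} (n : Fin r → ℕ) (k : ℕ) : ℕ :=
  if h : k < r then n ⟨r - 1 - k, by omega⟩ else 1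

/-! Write u* for the image of u under the linear extension of g ↦ g⁻¹. Since ⟨u, v⟩ is the
coefficient of u*v at 1, the dual of a two-sided ideal C is the annihilator {v : u*v = 0 for all u ∈
C}, again a two-sided ideal. A hull of dimension 3 exists exactly when some two-sided ideal I of
codimension 3 satisfies I + I* = F[G]. Given such an I, its dual lies in I and is its own hull
(`exists_hull_finrank_of_coprime`); conversely, by semisimplicity, the dual of a hull is such an I
(`exists_coprime_of_hull`).

A semisimple quotient of dimension 3 over a finite field is a product of fields, of degrees 1+1+1,
1+2 or 3. So I is cut out by characters of the abelianization, and I + I* = F[G] says that none of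
them is Galois conjugate to the inverse of itself or of another one. Degrees 1+1+1 require three
distinct pairs {χ, χ⁻¹} of F-valued characters with χ ≠ χ⁻¹; counting characters by the invariant
factors gives conditions 1-4 (`exists_three_characters_iff`). Degrees 1+2 require an F-valued
character of order at least 3 and a quadratic one not conjugate to its inverse: gcd(n_r, q²-1)
divides neither q-1 nor q+1 (condition 5). In degree 3 the Galois group has odd order, so a
character that generates the cubic field is never conjugate to its inverse (condition 6). The two
directions rest on `necessary_of_hull` and `exists_hull_of_maximal`. -/

open MonoidAlgebra

/-! ### Inversion, the inner product, and duals of ideals. -/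

/-- The anti-automorphism of the group algebra that inverts the group elements, as a homomorphism
to the opposite algebra. -/
noncomputable def inversionHom (F G : Type*) [Field F] [Group G] :
    MonoidAlgebra F G →ₐ[F] (MonoidAlgebra F G)ᵐᵒᵖ :=
  MonoidAlgebra.lift F _ G
    { toFun := fun g => MulOpposite.op (single g⁻¹ 1)
      map_one' := by simp [MonoidAlgebra.one_def]
      map_mul' := fun g h => by
        rw [← MulOpposite.op_mul, single_mul_single, mul_inv_rev, one_mul] }

/-- The linear involution of the group algebra that inverts the group elements. -/
noncomputable def inversion {F G : Type*} [Field F] [Group G] :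
    MonoidAlgebra F G →ₗ[F] MonoidAlgebra F G :=
  (MulOpposite.opLinearEquiv F).symm.toLinearMap ∘ₗ (inversionHom F G).toLinearMap

lemma groupAlgebraInner_comm {F G : Type*} [Field F] [Fintype G] (u v : MonoidAlgebra F G) :
    groupAlgebraInner u v = groupAlgebraInner v u := by
  simp [groupAlgebraInner, mul_comm]

section Inversion

variable {F G : Type*} [Field F] [Group G]

@[simp] lemma inversion_single (g : G) (a : F) : inversion (single g a) = single g⁻¹ a := by
  simp [inversion, inversionHom]

lemma inversion_mul (x y : MonoidAlgebra F G) :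
    inversion (x * y) = inversion y * inversion x := by
  simp [inversion]

@[simp] lemma inversion_inversion (x : MonoidAlgebra F G) : inversion (inversion x) = x := by
  induction x using MonoidAlgebra.induction_linear with
  | zero => simp
  | add f g hf hg => simp [hf, hg]
  | single g a => simp

lemma inversion_mapDomainAlgHom {H : Type*} [Group H] (f : G →* H) (x : MonoidAlgebra F G) :
    inversion (mapDomainAlgHom F F f x) = mapDomainAlgHom F F f (inversion x) := by
  induction x using MonoidAlgebra.induction_linear with
  | zero => simp only [map_zero]
  | add f g hf hg => simp only [map_add, hf, hg]
  | single g a => simp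

variable [Fintype G]

lemma groupAlgebraInner_eq (u v : MonoidAlgebra F G) :
    groupAlgebraInner u v = (inversion u * v).coeff 1 := by
  classical
  induction u using MonoidAlgebra.induction_linear with
  | zero => simp [groupAlgebraInner]
  | add f g hf hg =>
    simp only [groupAlgebraInner] at hf hg ⊢
    simp [add_mul, Finset.sum_add_distrib, hf, hg]
  | single g a =>
    simp [groupAlgebraInner, Finsupp.single_apply]

lemma groupAlgebraInner_inversion (u v : MonoidAlgebra F G) :
    groupAlgebraInner (inversion u) (inversion v) = groupAlgebraInner u v := by
  have h : ∀ (x : MonoidAlgebra F G) (g : G), (inversion x).coeff g = x.coeff g⁻¹ := by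
    classical
    intro x g
    induction x using MonoidAlgebra.induction_linear with
    | zero => simp
    | add f g hf hg => simp [hf, hg]
    | single g a => simp [Finsupp.single_apply, inv_eq_iff_eq_inv]
  simp only [groupAlgebraInner, h]
  exact Fintype.sum_equiv (Equiv.inv G) _ _ fun _ => rfl

/-- The Euclidean inner product as a bilinear form. -/
noncomputable def innerForm (F G : Type*) [Field F] [Group G] [Fintype G] :
    LinearMap.BilinForm F (MonoidAlgebra F G) :=
  LinearMap.mk₂ F groupAlgebraInner
    (fun a b c => by simp [groupAlgebraInner, add_mul, Finset.sum_add_distrib])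
    (fun a b c => by simp [groupAlgebraInner, Finset.mul_sum, mul_assoc])
    (fun a b c => by simp [groupAlgebraInner, mul_add, Finset.sum_add_distrib])
    (fun a b c => by simp [groupAlgebraInner, Finset.mul_sum, mul_left_comm])

lemma innerForm_isRefl : (innerForm F G).IsRefl := fun x y h => by
  rw [← h]
  exact groupAlgebraInner_comm y x

lemma innerForm_nondegenerate : (innerForm F G).Nondegenerate := by
  classical
  refine (LinearMap.IsRefl.nondegenerate_iff_separatingLeft (B := innerForm F G)
    innerForm_isRefl).2 fun x hx => ?_
  ext g
  have : groupAlgebraInner x (single g 1) = 0 := hx (single g 1)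
  simpa [groupAlgebraInner, Finsupp.single_apply] using this

lemma dualCode_eq_orthogonal (C : Submodule F (MonoidAlgebra F G)) :
    dualCode C = (innerForm F G).orthogonal C := by
  ext v
  refine forall₂_congr fun u _ => ?_
  rw [groupAlgebraInner_comm]
  rfl

lemma dualCode_dualCode (C : Submodule F (MonoidAlgebra F G)) : dualCode (dualCode C) = C := by
  rw [dualCode_eq_orthogonal, dualCode_eq_orthogonal,
    LinearMap.BilinForm.orthogonal_orthogonal innerForm_nondegenerate innerForm_isRefl]

lemma finrank_quotient_dualCode (C : Submodule F (MonoidAlgebra F G)) :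
    Module.finrank F (MonoidAlgebra F G ⧸ dualCode C) = Module.finrank F C := by
  have h1 := Submodule.finrank_quotient_add_finrank (dualCode C)
  have h2 := Submodule.finrank_le C
  rw [dualCode_eq_orthogonal] at h1 ⊢
  rw [LinearMap.BilinForm.finrank_orthogonal innerForm_nondegenerate] at h1
  omega

/-- The coefficient of u*v at g is the inner product of v with ug, so closure under right
multiplication makes every coefficient vanish. -/
lemma mem_dualCode_iff {C : Submodule F (MonoidAlgebra F G)}
    (hC : ∀ u ∈ C, ∀ x, u * x ∈ C) {v : MonoidAlgebra F G} :
    v ∈ dualCode C ↔ ∀ u ∈ C, inversion u * v = 0 := by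
  refine ⟨fun h u hu => ?_, fun h u hu => ?_⟩
  · ext g
    have := h _ (hC u hu (single g 1))
    rw [groupAlgebraInner_comm, groupAlgebraInner_eq, inversion_mul, mul_assoc] at this
    simpa using this
  · rw [groupAlgebraInner_comm, groupAlgebraInner_eq, h u hu]
    simp

/-- The dual of a group code, as an ideal. -/
noncomputable def dualIdeal (I : Ideal (MonoidAlgebra F G)) : Ideal (MonoidAlgebra F G) where
  carrier := {v | ∀ u ∈ I, inversion u * v = 0}
  add_mem' ha hb u hu := by rw [mul_add, ha u hu, hb u hu, add_zero]
  zero_mem' u _ := mul_zero _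
  smul_mem' x v hv u hu := by
    have := hv _ (I.mul_mem_left (inversion x) hu)
    rwa [inversion_mul, inversion_inversion, mul_assoc] at this

instance (I : Ideal (MonoidAlgebra F G)) : (dualIdeal I).IsTwoSided where
  mul_mem_of_left {a} b ha u hu := by rw [← mul_assoc, ha u hu, zero_mul]

lemma restrictScalars_dualIdeal (I : Ideal (MonoidAlgebra F G)) [I.IsTwoSided] :
    (dualIdeal I).restrictScalars F = dualCode (I.restrictScalars F) := by
  ext v
  exact (mem_dualCode_iff (C := I.restrictScalars F) fun u hu x => I.mul_mem_right x hu).symm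

end Inversion

/-! ### Hulls versus ideals I with I + I* = F[G]. -/

lemma exists_hull_finrank_of_coprime {F G : Type*} [Field F] [Group G] [Fintype G]
    (I : Ideal (MonoidAlgebra F G)) [I.IsTwoSided]
    (h : ∃ a ∈ I, ∃ b ∈ I, a + inversion b = 1) :
    ∃ C : Ideal (MonoidAlgebra F G), C.IsTwoSided ∧
      Module.finrank F (codeHull (C.restrictScalars F)) =
        Module.finrank F (MonoidAlgebra F G ⧸ I.restrictScalars F) := by
  refine ⟨dualIdeal I, inferInstance, ?_⟩
  have hle : dualIdeal I ≤ I := by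
    obtain ⟨a, ha, b, hb, hab⟩ := h
    intro v hv
    -- Multiply 1 = a + b* by v; b*v = 0 because v lies in the dual.
    have : v = a * v := by
      rw [eq_sub_of_add_eq hab, sub_mul, one_mul, hv b hb, sub_zero]
    rw [this]
    exact I.mul_mem_right v ha
  have : codeHull ((dualIdeal I).restrictScalars F) = dualCode (I.restrictScalars F) := by
    rw [codeHull, restrictScalars_dualIdeal, dualCode_dualCode, ← restrictScalars_dualIdeal]
    exact inf_eq_left.2 hle
  rw [this, ← finrank_quotient_dualCode, dualCode_dualCode]

lemma exists_coprime_of_hull {F G : Type*} [Field F] [Group G] [Fintype G]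
    [IsSemisimpleRing (MonoidAlgebra F G)]
    (C : Ideal (MonoidAlgebra F G)) [C.IsTwoSided] :
    ∃ I : Ideal (MonoidAlgebra F G), I.IsTwoSided ∧
      Module.finrank F (MonoidAlgebra F G ⧸ I.restrictScalars F) =
        Module.finrank F (codeHull (C.restrictScalars F)) ∧
      ∃ a ∈ I, ∃ b ∈ I, a + inversion b = 1 := by
  set H : Ideal (MonoidAlgebra F G) := C ⊓ dualIdeal C with hH
  have hull_eq : codeHull (C.restrictScalars F) = H.restrictScalars F := by
    rw [codeHull, ← restrictScalars_dualIdeal]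
    rfl
  have hHts : H.IsTwoSided := ⟨fun b ha => ⟨C.mul_mem_right b ha.1, (dualIdeal C).mul_mem_right b ha.2⟩⟩
  refine ⟨dualIdeal H, inferInstance, ?_, ?_⟩
  · rw [hull_eq, restrictScalars_dualIdeal, finrank_quotient_dualCode]
  -- N = H ∩ H*. Its idempotent generator e is killed by u* for every u in C; the choice u = e*
  -- gives e = e² = 0.
  let N : Ideal (MonoidAlgebra F G) :=
    { carrier := {x | x ∈ H ∧ inversion x ∈ H}
      add_mem' := fun ha hb => ⟨add_mem ha.1 hb.1, by rw [map_add]; exact add_mem ha.2 hb.2⟩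
      zero_mem' := ⟨zero_mem _, by simp⟩
      smul_mem' := fun c x hx => ⟨H.mul_mem_left c hx.1, by
        rw [smul_eq_mul, inversion_mul]; exact H.mul_mem_right _ hx.2⟩ }
  have hN : N = ⊥ := by
    obtain ⟨e, he, hNe⟩ := IsSemisimpleRing.ideal_eq_span_idempotent N
    have heN : e ∈ N := hNe ▸ Ideal.mem_span_singleton_self e
    have : e * e = 0 := by
      have := heN.1.2 _ heN.2.1
      rwa [inversion_inversion] at this
    rw [hNe, ← he.eq, this]
    simp
  -- W is the sum of the dual of H and its inversion, so its dual is H ∩ H* = 0 and W is everything.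
  let W : Submodule F (MonoidAlgebra F G) :=
    (dualIdeal H).restrictScalars F ⊔ ((dualIdeal H).restrictScalars F).map inversion
  have hW : dualCode W = ⊥ := by
    rw [eq_bot_iff]
    intro x hx
    have h1 : x ∈ H := by
      change x ∈ H.restrictScalars F
      rw [← dualCode_dualCode (H.restrictScalars F), ← restrictScalars_dualIdeal]
      exact fun u hu => hx u (Submodule.mem_sup_left hu)
    have h2 : inversion x ∈ H := by
      change inversion x ∈ H.restrictScalars F
      rw [← dualCode_dualCode (H.restrictScalars F), ← restrictScalars_dualIdeal]
      intro u hu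
      rw [← groupAlgebraInner_inversion, inversion_inversion]
      exact hx _ (Submodule.mem_sup_right (Submodule.mem_map_of_mem hu))
    have : x ∈ N := ⟨h1, h2⟩
    rwa [hN] at this
  have hWtop : (1 : MonoidAlgebra F G) ∈ W := by
    rw [← dualCode_dualCode W, hW]
    intro u hu
    rw [(Submodule.mem_bot F).1 hu]
    simp [groupAlgebraInner]
  obtain ⟨a, ha, y, ⟨b, hb, rfl⟩, hab⟩ := Submodule.mem_sup.1 hWtop
  exact ⟨a, ha, b, hb, hab⟩

/-! ### Three-dimensional semisimple quotients. -/

/-- A semisimple algebra of dimension at most three over a finite field is a product of fields. -/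
lemma exists_algEquiv_pi_field.{u, v} {F : Type u} {B : Type v} [Field F] [Finite F] [Ring B] [Algebra F B]
    [Module.Finite F B] [IsSemisimpleRing B] (hB : Module.finrank F B ≤ 3) :
    ∃ (k : ℕ) (K : Fin k → Type v) (_ : ∀ i, Field (K i)) (_ : ∀ i, Algebra F (K i))
      (_ : ∀ i, Module.Finite F (K i)), Nonempty (B ≃ₐ[F] ∀ i, K i) := by
  obtain ⟨k, D, d, _, _, _, hd, ⟨e⟩⟩ :=
    IsSemisimpleRing.exists_algEquiv_pi_matrix_divisionRing_finite F B
  have hd1 : d = fun _ => 1 := by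
    funext i
    have h1 : Module.finrank F B =
        ∑ i, d i * d i * Module.finrank F (D i) := by
      rw [e.toLinearEquiv.finrank_eq, Module.finrank_pi_fintype]
      simp [Module.finrank_matrix]
    have h2 : d i * d i * Module.finrank F (D i) ≤ 3 := by
      refine le_trans ?_ (h1 ▸ hB)
      exact Finset.single_le_sum (f := fun i => d i * d i * Module.finrank F (D i))
        (fun _ _ => Nat.zero_le _) (Finset.mem_univ i)
    have h3 : 0 < Module.finrank F (D i) := Module.finrank_pos
    have h4 : d i ≠ 0 := (hd i).ne
    -- A matrix block of size 2 would already have dimension at least 4.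
    have h5 : d i < 2 := by
      by_contra! h
      nlinarith [Nat.mul_le_mul h h]
    omega
  subst hd1
  have : ∀ i, Finite (D i) := fun i => Module.finite_of_finite F
  let fld : ∀ i, Field (D i) := fun i => littleWedderburn (D i)
  refine ⟨k, D, fld, fun i => ‹∀ i, Algebra F (D i)› i, inferInstance, ⟨e.trans ?_⟩⟩
  refine AlgEquiv.piCongrRight fun i => ?_
  convert! Matrix.uniqueAlgEquiv (m := Fin 1) (A := D i) (R := F)

lemma exists_surjective_pi_field.{u, v} {F : Type u} {R : Type v} [Field F] [Finite F] [Ring R] [Algebra F R]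
    [Module.Finite F R] [IsSemisimpleRing R] (I : Ideal R) [I.IsTwoSided]
    (hI : Module.finrank F (R ⧸ I.restrictScalars F) = 3) :
    ∃ (k : ℕ) (K : Fin k → Type v) (_ : ∀ i, Field (K i)) (_ : ∀ i, Algebra F (K i))
      (_ : ∀ i, Module.Finite F (K i)) (f : ∀ i, R →ₐ[F] K i),
      ∑ i, Module.finrank F (K i) = 3 ∧ (∀ y : ∀ i, K i, ∃ x, ∀ i, f i x = y i) ∧
      ∀ x ∈ I, ∀ i, f i x = 0 := by
  have hfin : Module.finrank F (R ⧸ I) = 3 := hI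
  have := RingHom.isSemisimpleRing_of_surjective (Ideal.Quotient.mk I) Ideal.Quotient.mk_surjective
  obtain ⟨k, K, _, _, _, ⟨e⟩⟩ := exists_algEquiv_pi_field (F := F) (B := R ⧸ I) hfin.le
  refine ⟨k, K, inferInstance, inferInstance, inferInstance,
    fun i => (Pi.evalAlgHom F K i).comp (e.toAlgHom.comp (Ideal.Quotient.mkₐ F I)), ?_, ?_, ?_⟩
  · rw [← hfin, e.toLinearEquiv.finrank_eq, Module.finrank_pi_fintype]
  · intro y
    obtain ⟨x, hx⟩ := Ideal.Quotient.mk_surjective (I := I) (e.symm y)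
    exact ⟨x, fun i => by simp [hx]⟩
  · intro x hx i
    simp [Ideal.Quotient.eq_zero_iff_mem.2 hx]

/-! ### Values of algebra homomorphisms at group elements. -/

section AlgHom

variable {F G K : Type*} [Field F] [Group G] [Field K] [Algebra F K]

lemma exists_single_notMem_range (f : MonoidAlgebra F G →ₐ[F] K) (hf : Function.Surjective f)
    (hK : Module.finrank F K ≠ 1) :
    ∃ g : G, f (single g 1) ∉ (algebraMap F K).range := by
  by_contra! h
  have h1 : ∀ x, f x ∈ (algebraMap F K).range := by
    intro x
    induction x using MonoidAlgebra.induction_linear with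
    | zero => simp only [map_zero, zero_mem]
    | add x y hx hy => rw [map_add]; exact add_mem hx hy
    | single g a =>
      have : (single g a : MonoidAlgebra F G) = algebraMap F _ a * single g 1 := by
        simp
      rw [this, map_mul, AlgHom.commutes]
      exact mul_mem ⟨a, rfl⟩ (h g)
  refine hK (Module.finrank_eq_of_rank_eq ?_)
  have : (⊥ : Subalgebra F K) = ⊤ := by
    rw [eq_top_iff]
    intro y _
    obtain ⟨x, rfl⟩ := hf y
    exact h1 x
  rw [Subalgebra.bot_eq_top_iff_rank_eq_one.1 this]
  simp

/-- Otherwise f(x*) = f'(x) for all x, and applying f to a + b* = 1 gives 0 = 1. -/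
lemma exists_single_inv_ne {f f' : MonoidAlgebra F G →ₐ[F] K} {a b : MonoidAlgebra F G}
    (ha : f a = 0) (hb : f' b = 0) (hab : a + inversion b = 1) :
    ∃ g : G, f (single g⁻¹ 1) ≠ f' (single g 1) := by
  by_contra! h
  have h1 : ∀ x, f (inversion x) = f' x := by
    intro x
    induction x using MonoidAlgebra.induction_linear with
    | zero => simp only [map_zero]
    | add x y hx hy => simp only [map_add, hx, hy]
    | single g c =>
      have (g : G) : (single g c : MonoidAlgebra F G) = algebraMap F _ c * single g 1 := by
        simp
      rw [inversion_single, this, this g, map_mul, map_mul, AlgHom.commutes, AlgHom.commutes, h]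
  have h2 := congrArg f hab
  rw [map_add, ha, h1, hb, map_one, add_zero] at h2
  exact zero_ne_one h2

lemma pow_single_eq_one (f : MonoidAlgebra F G →ₐ[F] K) {N : ℕ}
    (hN : ∀ g : Abelianization G, g ^ N = 1) (g : G) : f (single g 1) ^ N = 1 := by
  let χ : G →* Kˣ := MonoidHom.toHomUnits ((f : MonoidAlgebra F G →* K).comp (MonoidAlgebra.of F G))
  have h1 : χ g ^ N = 1 := by
    have := congrArg (Abelianization.lift χ) (hN (Abelianization.of g))
    simpa using this
  simpa [χ] using congrArg Units.val h1

lemma single_inv_eq (f : MonoidAlgebra F G →ₐ[F] K) (g : G) :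
    f (single g⁻¹ 1) = (f (single g 1))⁻¹ := by
  refine eq_inv_of_mul_eq_one_left ?_
  rw [← map_mul, single_mul_single]
  simp [← MonoidAlgebra.one_def]

lemma apply_single_ne_zero (f : MonoidAlgebra F G →ₐ[F] K) (g : G) :
    f (single g 1) ≠ 0 := by
  intro h
  have : f (single g 1 * single g⁻¹ 1) = 1 := by
    rw [single_mul_single]
    simp [← MonoidAlgebra.one_def]
  rw [map_mul, h, zero_mul] at this
  exact zero_ne_one this

/-- The polynomial X^q - X has at most q roots, and the elements of F already supply q of them. -/
lemma mem_range_algebraMap_of_pow_card [Fintype F] {x : K} (hx : x ^ Fintype.card F = x) :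
    x ∈ (algebraMap F K).range := by
  classical
  by_contra hr
  have hdeg := FiniteField.X_pow_card_sub_X_natDegree_eq K (Fintype.one_lt_card (α := F))
  have hne := FiniteField.X_pow_card_sub_X_ne_zero K (Fintype.one_lt_card (α := F))
  let S : Finset K := Finset.univ.map ⟨algebraMap F K, (algebraMap F K).injective⟩
  have hx' : x ∉ S := by simpa [S] using hr
  have := Polynomial.card_le_degree_of_subset_roots (Z := insert x S)
    (p := (Polynomial.X ^ Fintype.card F - Polynomial.X : Polynomial K)) (by
      intro y hy
      rw [Polynomial.mem_roots hne]
      rcases Finset.mem_insert.1 hy with rfl | hy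
      · simp [hx]
      · obtain ⟨c, -, rfl⟩ := Finset.mem_map.1 hy
        simp [← map_pow, FiniteField.pow_card])
  rw [Finset.card_insert_of_notMem hx', hdeg] at this
  simp [S] at this

lemma pow_card_pow_finrank_sub_one [Fintype F] [Module.Finite F K] {x : K} (hx : x ≠ 0) :
    x ^ (Fintype.card F ^ Module.finrank F K - 1) = 1 := by
  have := Module.finite_of_finite F (M := K)
  let := Fintype.ofFinite K
  rw [← Module.card_eq_pow_finrank]
  exact FiniteField.pow_card_sub_one_eq_one x hx

end AlgHom

/-! ### Necessary conditions from a hull of dimension 3. -/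

section Necessity

variable {F G K : Type*} [Field F] [Group G] [Field K] [Algebra F K]

/-- The character of the abelianization defined by an algebra homomorphism. -/
noncomputable def characterOf (f : MonoidAlgebra F G →ₐ[F] K) : Abelianization G →* Kˣ :=
  Abelianization.lift
    (MonoidHom.toHomUnits ((f : MonoidAlgebra F G →* K).comp (MonoidAlgebra.of F G)))

lemma characterOf_of (f : MonoidAlgebra F G →ₐ[F] K) (g : G) :
    (characterOf f (Abelianization.of g) : K) = f (single g 1) := by
  simp [characterOf]

lemma characterOf_injective :
    Function.Injective (characterOf : (MonoidAlgebra F G →ₐ[F] K) → Abelianization G →* Kˣ) := by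
  intro f f' h
  ext g
  have := congrArg Units.val (DFunLike.congr_fun h (Abelianization.of g))
  rw [characterOf_of, characterOf_of] at this
  simpa using this

lemma characterOf_ne_inv {f f' : MonoidAlgebra F G →ₐ[F] K} {a b : MonoidAlgebra F G}
    (ha : f a = 0) (hb : f' b = 0) (hab : a + inversion b = 1) :
    characterOf f ≠ (characterOf f')⁻¹ := by
  intro h
  obtain ⟨g, hg⟩ := exists_single_inv_ne ha hb hab
  refine hg ?_
  rw [single_inv_eq, ← characterOf_of, h, ← characterOf_of]
  simp

lemma exists_characters_of_finrank_eq_one {K : Fin 3 → Type*} [∀ i, Field (K i)]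
    [∀ i, Algebra F (K i)] (hK : ∀ i, Module.finrank F (K i) = 1)
    (f : ∀ i, MonoidAlgebra F G →ₐ[F] K i) (hf : ∀ y : ∀ i, K i, ∃ x, ∀ i, f i x = y i)
    {a b : MonoidAlgebra F G} (ha : ∀ i, f i a = 0) (hb : ∀ i, f i b = 0)
    (hab : a + inversion b = 1) :
    ∃ χ : Fin 3 → Abelianization G →* Fˣ, Function.Injective χ ∧ ∀ i j, χ i ≠ (χ j)⁻¹ := by
  classical
  let e (i : Fin 3) : F ≃ₐ[F] K i := AlgEquiv.ofBijective (Algebra.ofId F (K i))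
    (Algebra.finrank_eq_one_iff_bijective_algebraMap.1 (hK i))
  refine ⟨fun i => characterOf ((e i).symm.toAlgHom.comp (f i)), fun i j hij => ?_,
    fun i j => characterOf_ne_inv (a := a) (b := b) (by simp [ha]) (by simp [hb]) hab⟩
  by_contra hne
  -- Joint surjectivity separates the factors: this x has image 1 in factor i and 0 in factor j.
  obtain ⟨x, hx⟩ := hf (Pi.single i 1)
  have h := DFunLike.congr_fun (characterOf_injective hij) x
  simp [hx, Pi.single_eq_of_ne (Ne.symm hne)] at h

variable [Fintype F]

lemma pow_single_eq_one_of_gcd_dvd [Module.Finite F K] (f : MonoidAlgebra F G →ₐ[F] K) {N m : ℕ}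
    (hN : ∀ g : Abelianization G, g ^ N = 1)
    (hm : Nat.gcd N (Fintype.card F ^ Module.finrank F K - 1) ∣ m) (g : G) :
    f (single g 1) ^ m = 1 := by
  refine orderOf_dvd_iff_pow_eq_one.1 (dvd_trans (Nat.dvd_gcd ?_ ?_) hm)
  · exact orderOf_dvd_of_pow_eq_one (pow_single_eq_one f hN g)
  · exact orderOf_dvd_of_pow_eq_one (pow_card_pow_finrank_sub_one (F := F) (apply_single_ne_zero f g))

lemma not_gcd_dvd_of_surjective [Module.Finite F K] (f : MonoidAlgebra F G →ₐ[F] K)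
    (hf : Function.Surjective f) (hK : Module.finrank F K ≠ 1) {N : ℕ}
    (hN : ∀ g : Abelianization G, g ^ N = 1) :
    ¬ Nat.gcd N (Fintype.card F ^ Module.finrank F K - 1) ∣ Fintype.card F - 1 := by
  intro hm
  obtain ⟨g, hg⟩ := exists_single_notMem_range f hf hK
  refine hg (mem_range_algebraMap_of_pow_card ?_)
  rw [← Nat.sub_add_cancel (Fintype.card_pos (α := F)), pow_succ]
  rw [show Nat.succ 0 = 1 from rfl, pow_single_eq_one_of_gcd_dvd f hN hm, one_mul]

/-- If all values had order dividing q + 1, inversion would act on them as Frobenius; but f followed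
by Frobenius also kills b. -/
lemma not_gcd_dvd_card_add_one [Module.Finite F K] {f : MonoidAlgebra F G →ₐ[F] K}
    {a b : MonoidAlgebra F G}
    (ha : f a = 0) (hb : f b = 0) (hab : a + inversion b = 1) {N : ℕ}
    (hN : ∀ g : Abelianization G, g ^ N = 1) :
    ¬ Nat.gcd N (Fintype.card F ^ Module.finrank F K - 1) ∣ Fintype.card F + 1 := by
  intro hm
  obtain ⟨g, hg⟩ := exists_single_inv_ne (f := f)
    (f' := (FiniteField.frobeniusAlgHom F K).comp f) ha (by simp [hb]) hab
  refine hg ?_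
  rw [single_inv_eq, AlgHom.comp_apply, FiniteField.frobeniusAlgHom_apply]
  refine (eq_inv_of_mul_eq_one_left ?_).symm
  rw [← pow_succ, pow_single_eq_one_of_gcd_dvd f hN hm]

lemma not_gcd_dvd_two [Module.Finite F K] {f : MonoidAlgebra F G →ₐ[F] K}
    {a b : MonoidAlgebra F G}
    (ha : f a = 0) (hb : f b = 0) (hab : a + inversion b = 1) {N : ℕ}
    (hN : ∀ g : Abelianization G, g ^ N = 1) :
    ¬ Nat.gcd N (Fintype.card F ^ Module.finrank F K - 1) ∣ 2 := by
  intro hm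
  obtain ⟨g, hg⟩ := exists_single_inv_ne (f := f) (f' := f) ha hb hab
  refine hg ?_
  rw [single_inv_eq]
  refine (eq_inv_of_mul_eq_one_left ?_).symm
  rw [← sq, pow_single_eq_one_of_gcd_dvd f hN hm]

lemma necessary_of_hull [Fintype G] [IsSemisimpleRing (MonoidAlgebra F G)]
    (C : Ideal (MonoidAlgebra F G)) [C.IsTwoSided]
    (hC : Module.finrank F (codeHull (C.restrictScalars F)) = 3) {N : ℕ}
    (hN : ∀ g : Abelianization G, g ^ N = 1) :
    (∃ χ : Fin 3 → Abelianization G →* Fˣ, Function.Injective χ ∧ ∀ i j, χ i ≠ (χ j)⁻¹) ∨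
    (¬ Nat.gcd N (Fintype.card F ^ 2 - 1) ∣ Fintype.card F - 1 ∧
      ¬ Nat.gcd N (Fintype.card F - 1) ∣ 2 ∧
      ¬ Nat.gcd N (Fintype.card F ^ 2 - 1) ∣ Fintype.card F + 1) ∨
    ¬ Nat.gcd N (Fintype.card F ^ 3 - 1) ∣ Fintype.card F - 1 := by
  obtain ⟨I, _, hI, a, ha, b, hb, hab⟩ := exists_coprime_of_hull C
  obtain ⟨k, K, _, _, _, f, hsum, hf, hker⟩ := exists_surjective_pi_field I (hI.trans hC)
  have hpos : ∀ i, 0 < Module.finrank F (K i) := fun i => Module.finrank_pos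
  have hsurj : ∀ i, Function.Surjective (f i) := fun i y => by
    classical
    obtain ⟨x, hx⟩ := hf (Pi.single i y)
    exact ⟨x, by simp [hx]⟩
  have mixed : ∀ i j, Module.finrank F (K i) = 1 → Module.finrank F (K j) = 2 →
      (¬ Nat.gcd N (Fintype.card F ^ 2 - 1) ∣ Fintype.card F - 1 ∧
      ¬ Nat.gcd N (Fintype.card F - 1) ∣ 2 ∧
      ¬ Nat.gcd N (Fintype.card F ^ 2 - 1) ∣ Fintype.card F + 1) := by
    intro i j hi hj
    have h1 := not_gcd_dvd_of_surjective (f j) (hsurj j) (by omega) hN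
    have h2 := not_gcd_dvd_two (hker a ha i) (hker b hb i) hab hN
    have h3 := not_gcd_dvd_card_add_one (hker a ha j) (hker b hb j) hab hN
    rw [hj] at h1 h3
    rw [hi, pow_one] at h2
    exact ⟨h1, h2, h3⟩
  have hk : k ≤ 3 := by
    rw [← hsum]
    calc k = ∑ i : Fin k, 1 := by simp
      _ ≤ _ := Finset.sum_le_sum fun i _ => hpos i
  interval_cases k
  · simp at hsum
  · have h0 : Module.finrank F (K 0) = 3 := by simpa using hsum
    have h1 := not_gcd_dvd_of_surjective (f 0) (hsurj 0) (by omega) hN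
    rw [h0] at h1
    exact Or.inr (Or.inr h1)
  · rw [Fin.sum_univ_two] at hsum
    have h0 := hpos 0
    have h1 := hpos 1
    by_cases h : Module.finrank F (K 0) = 1
    · exact Or.inr (Or.inl (mixed 0 1 h (by omega)))
    · exact Or.inr (Or.inl (mixed 1 0 (by omega) (by omega)))
  · rw [Fin.sum_univ_three] at hsum
    have h0 := hpos 0
    have h1 := hpos 1
    have h2 := hpos 2
    refine Or.inl (exists_characters_of_finrank_eq_one ?_ f hf (hker a ha) (hker b hb) hab)
    intro i
    fin_cases i <;> simp <;> omega

end Necessity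

/-! ### Hulls from maximal ideals of the commutative group algebra. -/

section CommGroupAlgebra

variable {F H : Type*} [Field F] [CommGroup H]

/-- Inversion of the group elements, an algebra endomorphism as the group is commutative. -/
noncomputable def inversionAlgHom (F H : Type*) [Field F] [CommGroup H] :
    MonoidAlgebra F H →ₐ[F] MonoidAlgebra F H :=
  mapDomainAlgHom F F (invMonoidHom : H →* H)

lemma inversionAlgHom_apply (x : MonoidAlgebra F H) : inversionAlgHom F H x = inversion x := by
  induction x using MonoidAlgebra.induction_linear with
  | zero => simp only [map_zero]
  | add f g hf hg => simp only [map_add, hf, hg]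
  | single g a => simp [inversionAlgHom]

lemma inversionAlgHom_surjective : Function.Surjective (inversionAlgHom F H) := fun x =>
  ⟨inversion x, by rw [inversionAlgHom_apply, inversion_inversion]⟩

end CommGroupAlgebra

/-- By the Chinese remainder theorem codimensions add up, and the intersection of the `J i` is
comaximal with its inversion because each `J i` is with each inverted `J j`. Everything is then
pulled back to F[G]. -/
lemma exists_hull_of_maximal {F G ι : Type*} [Field F] [Group G] [Fintype G] [Fintype ι]
    (J : ι → Ideal (MonoidAlgebra F (Abelianization G))) (hJ : ∀ i, (J i).IsMaximal)
    (hinj : Function.Injective J)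
    (hinv : ∀ i j, J i ≠ (J j).comap (inversionAlgHom F (Abelianization G))) :
    ∃ C : Ideal (MonoidAlgebra F G), C.IsTwoSided ∧
      Module.finrank F (codeHull (C.restrictScalars F)) =
        ∑ i, Module.finrank F (MonoidAlgebra F (Abelianization G) ⧸ J i) := by
  classical
  set A := MonoidAlgebra F (Abelianization G)
  set σ := inversionAlgHom F (Abelianization G)
  let π : MonoidAlgebra F G →ₐ[F] A := mapDomainAlgHom F F Abelianization.of
  have hπ : Function.Surjective π := by
    intro x
    induction x using MonoidAlgebra.induction_linear with
    | zero => exact ⟨0, map_zero _⟩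
    | add x y hx hy =>
      obtain ⟨x, rfl⟩ := hx
      obtain ⟨y, rfl⟩ := hy
      exact ⟨x + y, map_add _ _ _⟩
    | single g a =>
      obtain ⟨g, rfl⟩ := QuotientGroup.mk_surjective g
      exact ⟨single g a, by
        change mapDomainAlgHom F F Abelianization.of (single g a) = _
        rw [mapDomainAlgHom_apply, mapDomain_single]
        rfl⟩
  let I : Ideal (MonoidAlgebra F G) := (⨅ i, J i).comap π
  have hmem : ∀ x, x ∈ I ↔ ∀ i, π x ∈ J i := fun x => by simp [I, Ideal.mem_comap]
  let p : MonoidAlgebra F G →ₗ[F] ∀ i, A ⧸ J i :=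
    LinearMap.pi fun i => (Ideal.Quotient.mkₐ F (J i)).toLinearMap ∘ₗ π.toLinearMap
  have hp : LinearMap.ker p = I.restrictScalars F := by
    ext x
    rw [LinearMap.mem_ker, Submodule.restrictScalars_mem, hmem, funext_iff]
    exact forall_congr' fun i => Ideal.Quotient.eq_zero_iff_mem
  have hcop : Pairwise (Function.onFun IsCoprime J) := fun i j hij =>
    Ideal.isCoprime_of_isMaximal (fun h => hij (hinj h))
  have hps : Function.Surjective p := by
    intro y
    obtain ⟨x, hx⟩ := Ideal.pi_quotient_surjective hcop y
    obtain ⟨x, rfl⟩ := hπ x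
    exact ⟨x, funext hx⟩
  have hfin : Module.finrank F (MonoidAlgebra F G ⧸ I.restrictScalars F) =
      ∑ i, Module.finrank F (A ⧸ J i) := by
    rw [← hp, (p.quotKerEquivOfSurjective hps).finrank_eq, Module.finrank_pi_fintype]
  rw [← hfin]
  refine exists_hull_finrank_of_coprime I ?_
  have hsup : (⨅ i, J i) ⊔ (⨅ j, (J j).comap σ) = ⊤ := by
    have hmax : ∀ j, ((J j).comap σ).IsMaximal := fun j =>
      Ideal.comap_isMaximal_of_surjective _ inversionAlgHom_surjective
    have h1 : ∀ i, J i ⊔ (⨅ j, (J j).comap σ) = ⊤ := fun i => by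
      have := Ideal.sup_iInf_eq_top (s := Finset.univ) (I := J i) (J := fun j => (J j).comap σ)
        fun j _ => Ideal.isCoprime_iff_sup_eq.1 (Ideal.isCoprime_of_isMaximal (hinv i j))
      simpa using this
    have := Ideal.iInf_sup_eq_top (s := Finset.univ) (J := J) (I := ⨅ j, (J j).comap σ)
        fun i _ => h1 i
    simpa using this
  obtain ⟨a, ha, b, hb, hab⟩ := Submodule.mem_sup.1 (hsup ▸ Submodule.mem_top : (1 : A) ∈ _)
  rw [Ideal.mem_iInf] at ha hb
  obtain ⟨b', hb'⟩ := hπ (σ b)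
  have hb'I : b' ∈ I := (hmem b').2 fun j => by rw [hb']; exact hb j
  -- In the abelianized algebra, 1 - b'* becomes 1 - b = a.
  refine ⟨1 - inversion b', (hmem _).2 fun i => ?_, b', hb'I, sub_add_cancel _ _⟩
  have h2 : π (inversion b') = b := by
    rw [← inversion_mapDomainAlgHom]
    change inversion (π b') = b
    rw [hb', inversionAlgHom_apply, inversion_inversion]
  rw [map_sub, map_one, h2, ← eq_sub_of_add_eq hab]
  exact ha i

/-! ### Kernels of characters. -/

section CharacterIdeal

variable {F H K : Type*} [Field F] [CommGroup H] [Field K] [Algebra F K]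

/-- The evaluation of the group algebra at a character. -/
noncomputable def evalCharacter (F : Type*) {H K : Type*} [Field F] [CommGroup H] [Field K]
    [Algebra F K] (χ : H →* Kˣ) : MonoidAlgebra F H →ₐ[F] K :=
  MonoidAlgebra.lift F K H ((Units.coeHom K).comp χ)

/-- The ideal of the elements of the group algebra that vanish at a character. -/
noncomputable def characterIdeal (F : Type*) {H K : Type*} [Field F] [CommGroup H] [Field K]
    [Algebra F K] (χ : H →* Kˣ) : Ideal (MonoidAlgebra F H) :=
  RingHom.ker (evalCharacter F χ)

@[simp] lemma evalCharacter_single (χ : H →* Kˣ) (h : H) :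
    evalCharacter F χ (single h 1) = χ h := by
  simp [evalCharacter]

lemma mem_characterIdeal {χ : H →* Kˣ} {x : MonoidAlgebra F H} :
    x ∈ characterIdeal F χ ↔ evalCharacter F χ x = 0 := Iff.rfl

lemma comap_characterIdeal (χ : H →* Kˣ) :
    (characterIdeal F χ).comap (inversionAlgHom F H) = characterIdeal F χ⁻¹ := by
  have : (evalCharacter F χ).comp (inversionAlgHom F H) = evalCharacter F χ⁻¹ := by
    ext h
    simp [inversionAlgHom, evalCharacter]
  ext x
  rw [Ideal.mem_comap, mem_characterIdeal, mem_characterIdeal, ← this]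
  rfl

lemma isMaximal_characterIdeal {χ : H →* Kˣ} (hχ : Function.Surjective (evalCharacter F χ)) :
    (characterIdeal F χ).IsMaximal :=
  RingHom.ker_isMaximal_of_surjective _ hχ

lemma finrank_quotient_characterIdeal {χ : H →* Kˣ}
    (hχ : Function.Surjective (evalCharacter F χ)) :
    Module.finrank F (MonoidAlgebra F H ⧸ characterIdeal F χ) = Module.finrank F K :=
  (Ideal.quotientKerAlgEquivOfSurjective hχ).toLinearEquiv.finrank_eq

lemma evalCharacter_surjective_self (χ : H →* Fˣ) : Function.Surjective (evalCharacter F χ) :=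
  fun c => ⟨algebraMap F _ c, by rw [AlgHom.commutes]; rfl⟩

lemma evalCharacter_surjective_of_prime (hK : (Module.finrank F K).Prime) {χ : H →* Kˣ} {h : H}
    (hh : (χ h : K) ∉ (algebraMap F K).range) : Function.Surjective (evalCharacter F χ) := by
  have := Subalgebra.isSimpleOrder_of_finrank_prime F K hK
  rw [← AlgHom.range_eq_top]
  refine (IsSimpleOrder.eq_bot_or_eq_top _).resolve_left fun hbot => hh ?_
  have : (χ h : K) ∈ (evalCharacter F χ).range := ⟨single h 1, evalCharacter_single χ h⟩
  rw [hbot] at this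
  exact this

lemma characterIdeal_injective :
    Function.Injective (characterIdeal F : (H →* Fˣ) → Ideal (MonoidAlgebra F H)) := by
  intro χ ψ h
  ext g
  have h1 : single g 1 - algebraMap F _ (χ g : F) ∈ characterIdeal F χ := by
    rw [mem_characterIdeal, map_sub, evalCharacter_single, AlgHom.commutes]
    exact sub_self _
  rw [h, mem_characterIdeal, map_sub, evalCharacter_single, AlgHom.commutes] at h1
  exact (sub_eq_zero.1 h1).symm

/-- Equal kernels give χ(h) and χ(h)⁻¹ the same minimal polynomial over F, so some power of
Frobenius carries one to the other. -/
lemma exists_pow_eq_one_of_characterIdeal_eq [Fintype F] [Module.Finite F K] {χ : H →* Kˣ}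
    (hχ : characterIdeal F χ = characterIdeal F χ⁻¹) (h : H) :
    ∃ i < Module.finrank F K, χ h ^ (Fintype.card F ^ i + 1) = 1 := by
  have : Finite K := Module.finite_of_finite F
  have key : ∀ p : Polynomial F, Polynomial.aeval (χ h : K) p = 0 →
      Polynomial.aeval ((χ h : K)⁻¹) p = 0 := by
    intro p hp
    have h1 : Polynomial.aeval (single h 1 : MonoidAlgebra F H) p ∈ characterIdeal F χ := by
      rw [mem_characterIdeal, ← Polynomial.aeval_algHom_apply, evalCharacter_single, hp]
    rw [hχ, mem_characterIdeal, ← Polynomial.aeval_algHom_apply, evalCharacter_single] at h1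
    simpa using h1
  have hconj : IsConjRoot F (χ h : K) ((χ h : K)⁻¹) :=
    isConjRoot_of_aeval_eq_zero (Algebra.IsIntegral.isIntegral _) (key _ (minpoly.aeval F _))
  obtain ⟨s, hs⟩ := isConjRoot_iff_exists_algEquiv.1 hconj
  obtain ⟨⟨i, hi⟩, rfl⟩ := (FiniteField.bijective_frobeniusAlgEquivOfAlgebraic_pow F K).2 s
  refine ⟨i, hi, Units.ext ?_⟩
  simp only [AlgEquiv.coe_pow, FiniteField.coe_frobeniusAlgEquivOfAlgebraic_iterate] at hs
  rw [Units.val_pow_eq_pow_val, pow_succ, Units.val_one]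
  nth_rewrite 2 [← hs]
  rw [← mul_pow, mul_inv_cancel₀ (Units.ne_zero _), one_pow]

end CharacterIdeal

/-! ### Divisibility facts for character orders. -/

section Arithmetic

lemma not_dvd_two_of_dvd_pow_sub_one {m q d : ℕ} (hq : 0 < q) (hd : d ≠ 0)
    (h1 : m ∣ q ^ d - 1) (h2 : ¬ m ∣ q - 1) : ¬ m ∣ 2 := by
  intro h
  rcases (Nat.dvd_prime Nat.prime_two).1 h with rfl | rfl
  · exact h2 (one_dvd _)
  · refine h2 (even_iff_two_dvd.1 ?_)
    have h3 := even_iff_two_dvd.2 h1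
    rw [Nat.even_sub (Nat.one_le_pow _ _ hq), Nat.even_pow] at h3
    rw [Nat.even_sub hq]
    tauto

lemma not_dvd_pow_add_one_of_dvd_cube_sub_one {m q i : ℕ} (hq : 0 < q) (hi : i < 3)
    (h1 : m ∣ q ^ 3 - 1) (h2 : ¬ m ∣ q - 1) : ¬ m ∣ q ^ i + 1 := by
  intro h
  have hz : (m : ℤ) ∣ (q : ℤ) ^ 3 - 1 := by
    have := Int.natCast_dvd_natCast.2 h1
    rwa [Nat.cast_sub (Nat.one_le_pow _ _ hq), Nat.cast_pow, Nat.cast_one] at this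
  have hz2 : ¬ (m : ℤ) ∣ (q : ℤ) - 1 := by
    intro h3
    rw [← Nat.cast_one, ← Nat.cast_sub hq] at h3
    exact h2 (Int.natCast_dvd_natCast.1 h3)
  have hz3 : (m : ℤ) ∣ (q : ℤ) ^ i + 1 := by exact_mod_cast Int.natCast_dvd_natCast.2 h
  -- Uses q³ - 1 = (q - 1)(q(q + 1) + 1). The case i = 2 reduces to this one through q(q² + 1) - (q³
  -- - 1) = q + 1.
  have key : (m : ℤ) ∣ (q : ℤ) + 1 → False := by
    rintro ⟨c, hc⟩
    obtain ⟨e, he⟩ := hz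
    exact hz2 ⟨e - q * (q - 1) * c, by linear_combination he - q * (q - 1) * hc⟩
  interval_cases i
  · exact not_dvd_two_of_dvd_pow_sub_one hq three_ne_zero h1 h2 (by simpa using h)
  · exact key (by simpa using hz3)
  · obtain ⟨c, hc⟩ := hz3
    obtain ⟨e, he⟩ := hz
    exact key ⟨q * c - e, by linear_combination q * hc - he⟩

end Arithmetic

lemma notMem_range_of_orderOf {F K : Type*} [Field F] [Fintype F] [Field K] [Algebra F K]
    {x : Kˣ} (hx : ¬ orderOf x ∣ Fintype.card F - 1) :
    (x : K) ∉ (algebraMap F K).range := by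
  rintro ⟨c, hc⟩
  refine hx (orderOf_dvd_of_pow_eq_one (Units.ext ?_))
  have h0 : c ≠ 0 := by
    rintro rfl
    rw [map_zero] at hc
    exact x.ne_zero hc.symm
  rw [Units.val_pow_eq_pow_val, ← hc, ← map_pow, FiniteField.pow_card_sub_one_eq_one c h0,
    map_one, Units.val_one]

lemma exists_hull_of_linear_characters {F G : Type*} [Field F] [Group G] [Fintype G]
    {χ : Fin 3 → Abelianization G →* Fˣ}
    (h1 : Function.Injective χ) (h2 : ∀ i j, χ i ≠ (χ j)⁻¹) :
    ∃ C : Ideal (MonoidAlgebra F G), C.IsTwoSided ∧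
      Module.finrank F (codeHull (C.restrictScalars F)) = 3 := by
  obtain ⟨C, hC, hfin⟩ := exists_hull_of_maximal (F := F) (G := G)
    (fun i => characterIdeal F (χ i))
    (fun i => isMaximal_characterIdeal (evalCharacter_surjective_self (χ i)))
    (characterIdeal_injective.comp h1)
    (fun i j => by
      rw [comap_characterIdeal]
      exact fun heq => h2 i j (characterIdeal_injective heq))
  refine ⟨C, hC, hfin.trans ?_⟩
  simp [finrank_quotient_characterIdeal (evalCharacter_surjective_self _)]

/-! ### Hulls from cubic and quadratic characters. -/

section Sufficiency

variable {F G K : Type*} [Field F] [Fintype F] [Group G] [Fintype G] [Field K] [Algebra F K]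
  [Module.Finite F K]

lemma exists_hull_of_cubic_character (hK : Module.finrank F K = 3)
    (χ : Abelianization G →* Kˣ) (h : Abelianization G)
    (h1 : orderOf (χ h) ∣ Fintype.card F ^ 3 - 1) (h2 : ¬ orderOf (χ h) ∣ Fintype.card F - 1) :
    ∃ C : Ideal (MonoidAlgebra F G), C.IsTwoSided ∧
      Module.finrank F (codeHull (C.restrictScalars F)) = 3 := by
  have hs : Function.Surjective (evalCharacter F χ) :=
    evalCharacter_surjective_of_prime (hK ▸ Nat.prime_three) (notMem_range_of_orderOf h2)
  obtain ⟨C, hC, hfin⟩ := exists_hull_of_maximal (F := F) (G := G) (ι := Unit)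
    (fun _ => characterIdeal F χ) (fun _ => isMaximal_characterIdeal hs)
    (fun _ _ _ => rfl) (fun _ _ => by
      rw [comap_characterIdeal]
      intro heq
      obtain ⟨i, hi, hpow⟩ := exists_pow_eq_one_of_characterIdeal_eq heq h
      exact not_dvd_pow_add_one_of_dvd_cube_sub_one Fintype.card_pos (hK ▸ hi) h1 h2
        (orderOf_dvd_of_pow_eq_one hpow))
  refine ⟨C, hC, hfin.trans ?_⟩
  rw [Fintype.sum_unique, finrank_quotient_characterIdeal hs, hK]

lemma exists_hull_of_quadratic_character (hK : Module.finrank F K = 2)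
    (χ : Abelianization G →* Kˣ) (h : Abelianization G)
    (h1 : orderOf (χ h) ∣ Fintype.card F ^ 2 - 1) (h2 : ¬ orderOf (χ h) ∣ Fintype.card F - 1)
    (h3 : ¬ orderOf (χ h) ∣ Fintype.card F + 1)
    (ψ : Abelianization G →* Fˣ) (hψ : ψ ≠ ψ⁻¹) :
    ∃ C : Ideal (MonoidAlgebra F G), C.IsTwoSided ∧
      Module.finrank F (codeHull (C.restrictScalars F)) = 3 := by
  have hs : Function.Surjective (evalCharacter F χ) :=
    evalCharacter_surjective_of_prime (hK ▸ Nat.prime_two) (notMem_range_of_orderOf h2)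
  have hs' : Function.Surjective (evalCharacter F χ⁻¹) :=
    evalCharacter_surjective_of_prime (hK ▸ Nat.prime_two) (h := h)
      (notMem_range_of_orderOf (by rwa [MonoidHom.inv_apply, orderOf_inv]))
  have d1 := finrank_quotient_characterIdeal hs
  have d1' := finrank_quotient_characterIdeal hs'
  have d2 := finrank_quotient_characterIdeal (evalCharacter_surjective_self ψ)
  have d2' := finrank_quotient_characterIdeal (evalCharacter_surjective_self ψ⁻¹)
  rw [hK] at d1 d1'
  rw [Module.finrank_self] at d2 d2'
  -- Codimensions 2 and 1 separate the kernels of χ and its inverse from those of ψ and its inverse.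
  have n1 : characterIdeal F χ ≠ characterIdeal F ψ := by
    intro heq
    rw [heq] at d1
    omega
  have n2 : characterIdeal F χ ≠ characterIdeal F ψ⁻¹ := by
    intro heq
    rw [heq] at d1
    omega
  have n3 : characterIdeal F ψ ≠ characterIdeal F χ⁻¹ := by
    intro heq
    rw [heq] at d2
    omega
  have n4 : characterIdeal F ψ ≠ characterIdeal F ψ⁻¹ := fun heq =>
    hψ (characterIdeal_injective heq)
  have n5 : characterIdeal F χ ≠ characterIdeal F χ⁻¹ := by
    intro heq
    obtain ⟨i, hi, hpow⟩ := exists_pow_eq_one_of_characterIdeal_eq heq h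
    have hdvd := orderOf_dvd_of_pow_eq_one hpow
    rw [hK] at hi
    interval_cases i
    · exact not_dvd_two_of_dvd_pow_sub_one Fintype.card_pos two_ne_zero h1 h2 (by simpa using hdvd)
    · exact h3 (by simpa using hdvd)
  obtain ⟨C, hC, hfin⟩ := exists_hull_of_maximal (F := F) (G := G)
    ![characterIdeal F χ, characterIdeal F ψ]
    (Fin.forall_fin_two.2 ⟨isMaximal_characterIdeal hs,
      isMaximal_characterIdeal (evalCharacter_surjective_self ψ)⟩)
    (by
      intro i j hij
      fin_cases i <;> fin_cases j <;> simp at hij ⊢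
      exacts [n1 hij, n1 hij.symm])
    (by
      intro i j
      fin_cases i <;> fin_cases j <;> simp [comap_characterIdeal, n2, n3, n4, n5])
  refine ⟨C, hC, hfin.trans ((Fin.sum_univ_two _).trans ?_)⟩
  exact congrArg₂ (· + ·) d1 d2

end Sufficiency

/-! ### Characters of a sum of cyclic groups. -/

section InvariantFactors

variable {H : Type*} [CommGroup H] {r : ℕ} {n : Fin r → ℕ}

lemma dvd_factorFromTop (hn_dvd : ∀ i j, i ≤ j → n i ∣ n j) (i : Fin r) :
    n i ∣ factorFromTop n 0 := by
  have hr : 0 < r := i.pos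
  rw [factorFromTop, dif_pos hr]
  exact hn_dvd _ _ (Fin.le_def.2 (by simp; omega))

lemma pow_factorFromTop (hn_dvd : ∀ i j, i ≤ j → n i ∣ n j)
    (e : Additive H ≃+ ((i : Fin r) → ZMod (n i))) (g : H) : g ^ factorFromTop n 0 = 1 := by
  have h : factorFromTop n 0 • Additive.ofMul g = 0 := by
    apply e.injective
    rw [map_nsmul, map_zero]
    funext i
    obtain ⟨c, hc⟩ := dvd_factorFromTop hn_dvd i
    simp [hc]
  exact h

variable {U : Type*} [CommGroup U] (e : Additive H ≃+ ((i : Fin r) → ZMod (n i)))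

/-- The generators of the cyclic summands. -/
def cyclicGenerator (i : Fin r) : H := (e.symm (Pi.single i 1)).toMul

lemma cyclicGenerator_pow (i : Fin r) : cyclicGenerator e i ^ n i = 1 := by
  have h : n i • e.symm (Pi.single i 1) = 0 := by
    rw [← map_nsmul, ← Pi.single_smul]
    simp
  exact h

lemma monoidHom_ext_cyclicGenerator {χ ψ : H →* U}
    (h : ∀ i, χ (cyclicGenerator e i) = ψ (cyclicGenerator e i)) : χ = ψ := by
  have h2 : χ.toAdditive.comp e.symm.toAddMonoidHom = ψ.toAdditive.comp e.symm.toAddMonoidHom := by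
    refine AddMonoidHom.functions_ext _ _ _ fun i c => ?_
    obtain ⟨c, rfl⟩ := ZMod.intCast_surjective c
    have hc : (Pi.single i (c : ZMod (n i)) : (i : Fin r) → ZMod (n i)) = c • Pi.single i 1 := by
      rw [← Pi.single_smul]
      simp
    rw [hc, map_zsmul, map_zsmul]
    exact congrArg (fun u : Additive U => c • u) (h i)
  ext g
  have := DFunLike.congr_fun h2 (e (Additive.ofMul g))
  simpa using this

/-- The character of a direct sum of cyclic groups with prescribed values at the generators. -/
noncomputable def characterOfValues (x : Fin r → U) (hx : ∀ i, x i ^ n i = 1) : H →* U :=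
  MonoidHom.toAdditive.symm (∑ i,
    (ZMod.lift (n i) ⟨zmultiplesHom (Additive U) (Additive.ofMul (x i)), by
      rw [zmultiplesHom_apply, natCast_zsmul, ← ofMul_pow, hx]
      rfl⟩).comp ((Pi.evalAddMonoidHom _ i).comp e.toAddMonoidHom))

lemma characterOfValues_cyclicGenerator (x : Fin r → U) (hx : ∀ i, x i ^ n i = 1) (i : Fin r) :
    characterOfValues e x hx (cyclicGenerator e i) = x i := by
  classical
  apply Additive.ofMul.injective
  change (∑ j, _ : Additive H →+ Additive U) (e.symm (Pi.single i 1)) = _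
  rw [AddMonoidHom.finsetSum_apply, Finset.sum_eq_single i]
  · have h1 : (1 : ZMod (n i)) = ((1 : ℤ) : ZMod (n i)) := by simp
    simp only [AddMonoidHom.comp_apply, AddEquiv.coe_toAddMonoidHom, AddEquiv.apply_symm_apply,
      Pi.evalAddMonoidHom_apply, Pi.single_eq_same]
    rw [h1, ZMod.lift_coe]
    simp
  · intro j _ hj
    simp [Pi.single_eq_of_ne hj]
  · simp

lemma pow_eq_one_of_mem_ker_of_dvd {a b : ℕ} {x : U} (hx : x ∈ (powMonoidHom a : U →* U).ker)
    (h : a ∣ b) : x ^ b = 1 :=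
  orderOf_dvd_iff_pow_eq_one.1 ((orderOf_dvd_of_pow_eq_one hx).trans h)

/-- Characters of exponent dividing `m` correspond to their values at the generators. -/
noncomputable def characterEquiv (m : ℕ) :
    {χ : H →* U // χ ^ m = 1} ≃ ∀ i, (powMonoidHom (Nat.gcd (n i) m) : U →* U).ker where
  toFun χ i := ⟨χ.1 (cyclicGenerator e i), by
    rw [MonoidHom.mem_ker, powMonoidHom_apply, ← orderOf_dvd_iff_pow_eq_one]
    refine Nat.dvd_gcd (orderOf_dvd_of_pow_eq_one ?_) (orderOf_dvd_of_pow_eq_one ?_)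
    · rw [← map_pow, cyclicGenerator_pow, map_one]
    · exact DFunLike.congr_fun χ.2 (cyclicGenerator e i)⟩
  invFun x := ⟨characterOfValues e (fun i => x i) (fun i =>
      pow_eq_one_of_mem_ker_of_dvd (x i).2 (Nat.gcd_dvd_left _ _)), by
    refine monoidHom_ext_cyclicGenerator e fun i => ?_
    rw [MonoidHom.pow_apply, characterOfValues_cyclicGenerator, MonoidHom.one_apply]
    exact pow_eq_one_of_mem_ker_of_dvd (x i).2 (Nat.gcd_dvd_right _ _)⟩
  left_inv χ := Subtype.ext (monoidHom_ext_cyclicGenerator e fun i => by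
    simp only [characterOfValues_cyclicGenerator])
  right_inv x := funext fun i => Subtype.ext (by
    simp only [characterOfValues_cyclicGenerator])

/-- Each generator contributes a torsion subgroup of the cyclic group U. The value m = 0 counts all
characters, m = 2 those equal to their inverse. -/
lemma card_characters (e : Additive H ≃+ ((i : Fin r) → ZMod (n i))) [IsCyclic U] [Finite U] (m : ℕ) :
    Nat.card {χ : H →* U // χ ^ m = 1} = ∏ i, Nat.gcd (Nat.card U) (Nat.gcd (n i) m) := by
  rw [Nat.card_congr (characterEquiv e m), Nat.card_pi]
  exact Finset.prod_congr rfl fun i _ => IsCyclic.card_powMonoidHom_ker U _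

lemma exists_character_orderOf (e : Additive H ≃+ ((i : Fin r) → ZMod (n i))) [IsCyclic U] [Finite U] :
    ∃ (χ : H →* U) (h : H), orderOf (χ h) = Nat.gcd (factorFromTop n 0) (Nat.card U) := by
  by_cases hr : 0 < r
  · obtain ⟨g, hg⟩ := IsCyclic.exists_ofOrder_eq_natCard (α := U)
    let i : Fin r := ⟨r - 1 - 0, by omega⟩
    have hi : factorFromTop n 0 = n i := by rw [factorFromTop, dif_pos hr]
    let d := Nat.gcd (n i) (Nat.card U)
    have hd : d ∣ Nat.card U := Nat.gcd_dvd_right _ _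
    have hx : orderOf (g ^ (Nat.card U / d)) = d := by
      rw [orderOf_pow_of_dvd, hg, Nat.div_div_self hd Nat.card_pos.ne']
      · exact (Nat.div_pos (Nat.le_of_dvd Nat.card_pos hd) (Nat.gcd_pos_of_pos_right _ Nat.card_pos)).ne'
      · rw [hg]
        exact Nat.div_dvd_of_dvd hd
    classical
    -- The character lives on the largest cyclic summand, whose generator goes to an element of
    -- order d.
    refine ⟨characterOfValues e (Pi.mulSingle i (g ^ (Nat.card U / d))) fun j => ?_,
      cyclicGenerator e i, ?_⟩
    · rcases eq_or_ne j i with rfl | hj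
      · rw [Pi.mulSingle_eq_same, ← orderOf_dvd_iff_pow_eq_one, hx]
        exact Nat.gcd_dvd_left _ _
      · rw [Pi.mulSingle_eq_of_ne hj, one_pow]
    · rw [characterOfValues_cyclicGenerator, Pi.mulSingle_eq_same, hx, hi]
  · exact ⟨1, 1, by simp [factorFromTop, hr]⟩

end InvariantFactors

/-! ### Triples avoiding inverses in a finite abelian group. -/

section CommGroup

variable {X : Type*} [CommGroup X] [Finite X]

lemma card_add_card_eq : Nat.card {x : X // x ^ 2 = 1} + Nat.card {x : X // ¬ x ^ 2 = 1} =
    Nat.card X := by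
  classical
  rw [← Nat.card_sum]
  exact Nat.card_congr (Equiv.sumCompl fun x : X => x ^ 2 = 1)

/-- Elements with x² ≠ 1 come in pairs {x, x⁻¹}; an admissible triple represents three distinct
pairs, hence needs six such elements, and six suffice for a greedy choice. -/
lemma exists_three_iff_card :
    (∃ χ : Fin 3 → X, Function.Injective χ ∧ ∀ i j, χ i ≠ (χ j)⁻¹) ↔
      Nat.card {x : X // x ^ 2 = 1} + 6 ≤ Nat.card X := by
  classical
  have := Fintype.ofFinite X
  rw [← card_add_card_eq (X := X), Nat.add_le_add_iff_left, Nat.card_eq_fintype_card]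
  constructor
  · rintro ⟨χ, hinj, hinv⟩
    have hmem : ∀ i, ¬ χ i ^ 2 = 1 := fun i h => hinv i i (eq_inv_of_mul_eq_one_left (by rwa [← sq]))
    let f : Fin 3 ⊕ Fin 3 → {x : X // ¬ x ^ 2 = 1} :=
      Sum.elim (fun i => ⟨χ i, hmem i⟩) (fun i => ⟨(χ i)⁻¹, by rw [inv_pow, inv_eq_one]; exact hmem i⟩)
    have hf : Function.Injective f := by
      rintro (i | i) (j | j) h
      · exact congrArg _ (hinj (congrArg Subtype.val h))
      · exact absurd (congrArg Subtype.val h) (hinv i j)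
      · exact absurd (congrArg Subtype.val h).symm (hinv j i)
      · exact congrArg _ (hinj (inv_injective (congrArg Subtype.val h)))
    simpa using Fintype.card_le_of_injective f hf
  · intro h
    rw [Fintype.card_subtype] at h
    set T := Finset.univ.filter fun x : X => ¬ x ^ 2 = 1
    have step : ∀ S : Finset X, S.card < T.card → ∃ x, ¬ x ^ 2 = 1 ∧ x ∉ S := by
      intro S hS
      obtain ⟨x, hx, hxS⟩ := Finset.exists_mem_notMem_of_card_lt_card hS
      exact ⟨x, (Finset.mem_filter.1 hx).2, hxS⟩
    obtain ⟨a, ha, -⟩ := step ∅ (by rw [Finset.card_empty]; omega)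
    obtain ⟨b, hb, hb'⟩ := step {a, a⁻¹} (lt_of_le_of_lt Finset.card_le_two (by omega))
    obtain ⟨c, hc, hc'⟩ := step {a, a⁻¹, b, b⁻¹} (lt_of_le_of_lt Finset.card_le_four (by omega))
    simp only [Finset.mem_insert, Finset.mem_singleton, not_or] at hb' hc'
    have ne_inv : ∀ x : X, ¬ x ^ 2 = 1 → x ≠ x⁻¹ := fun x hx h => hx (by
      rw [sq]
      exact eq_inv_iff_mul_eq_one.1 h)
    have swap : ∀ x y : X, x ≠ y⁻¹ → y ≠ x⁻¹ := fun x y h h' => h (by rw [h', inv_inv])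
    refine ⟨![a, b, c], fun i j hij => ?_, fun i j => ?_⟩
    · fin_cases i <;> fin_cases j <;> simp at hij ⊢
      exacts [hb'.1 hij.symm, hc'.1 hij.symm, hb'.1 hij, hc'.2.2.1 hij.symm, hc'.1 hij,
        hc'.2.2.1 hij]
    · fin_cases i <;> fin_cases j
      exacts [ne_inv a ha, swap b a hb'.2, swap c a hc'.2.1, hb'.2, ne_inv b hb,
        swap c b hc'.2.2.2, hc'.2.1, hc'.2.2.2, ne_inv c hc]

end CommGroup

/-! ### The numerical criterion in the three largest invariant factors. -/

section Counting

variable {r : ℕ} {n : Fin r → ℕ}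

lemma factorFromTop_eq_one {k : ℕ} (hk : r ≤ k) : factorFromTop n k = 1 :=
  dif_neg (not_lt.2 hk)

lemma factorFromTop_dvd (hn_dvd : ∀ i j, i ≤ j → n i ∣ n j) {k l : ℕ} (hkl : k ≤ l) :
    factorFromTop n l ∣ factorFromTop n k := by
  by_cases hl : l < r
  · rw [factorFromTop, factorFromTop, dif_pos hl, dif_pos (hkl.trans_lt hl)]
    exact hn_dvd _ _ (Fin.le_def.2 (by simp; omega))
  · rw [factorFromTop_eq_one (not_lt.1 hl)]
    exact one_dvd _

lemma prod_eq_prod_factorFromTop (g : ℕ → ℕ) (hg : g 1 = 1) :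
    ∏ i, g (n i) = g (factorFromTop n 0) * g (factorFromTop n 1) * g (factorFromTop n 2) *
      ∏ k ∈ Finset.range r, g (factorFromTop n (3 + k)) := by
  have h1 : ∏ i, g (n i) = ∏ k ∈ Finset.range r, g (factorFromTop n k) := by
    rw [← Fin.prod_univ_eq_prod_range (fun k => g (factorFromTop n k)), ← Equiv.prod_comp Fin.revPerm]
    refine Finset.prod_congr rfl fun i _ => ?_
    rw [factorFromTop, dif_pos i.2]
    congr 2
    ext
    simp [Fin.val_rev]
    omega
  -- Padding by three trivial factors lets the top three be split off even when r < 3.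
  have h2 : ∏ k ∈ Finset.range (3 + r), g (factorFromTop n k) =
      ∏ k ∈ Finset.range r, g (factorFromTop n k) := by
    rw [add_comm, Finset.prod_range_add]
    have : ∀ k ∈ Finset.range 3, g (factorFromTop n (r + k)) = 1 := fun k _ => by
      rw [factorFromTop_eq_one (Nat.le_add_right r k), hg]
    rw [Finset.prod_congr rfl this]
    simp
  rw [h1, ← h2, Finset.prod_range_add]
  simp [Finset.prod_range_succ]

/-- A gap of 6 survives further factors (`grow`), so each listed case reduces to a small check. If
none holds, either a ≤ 2 and both products agree, or b ≤ 2 and c = Q = 1, leaving finitely many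
pairs. Here Q and Q' stand for the factors beyond the third. -/
lemma gcd_two_prod_add_six_le_iff {a b c Q Q' : ℕ} (ha : 0 < a) (hba : b ∣ a) (hcb : c ∣ b)
    (hQ' : 0 < Q') (hQ : Q' ≤ Q) (hc : c = 1 → Q = 1)
    (hc2 : c ∣ 2 → Q = Q') :
    Nat.gcd a 2 * Nat.gcd b 2 * Nat.gcd c 2 * Q' + 6 ≤ a * b * c * Q ↔
      7 ≤ a ∨ (5 ≤ a ∧ a ≤ 6 ∧ 2 ≤ b) ∨ (3 ≤ a ∧ a ≤ 4 ∧ 3 ≤ b) ∨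
        (3 ≤ a ∧ a ≤ 4 ∧ b = 2 ∧ c = 2) := by
  have hb : 0 < b := Nat.pos_of_dvd_of_pos hba ha
  have hc0 : 0 < c := Nat.pos_of_dvd_of_pos hcb hb
  have gpos : ∀ x, 0 < Nat.gcd x 2 := fun x => Nat.gcd_pos_of_pos_right _ two_pos
  have gle : ∀ x, 0 < x → Nat.gcd x 2 ≤ x := fun x hx => Nat.gcd_le_left _ hx
  have grow : ∀ u v x y : ℕ, v + 6 ≤ u → 0 < y → y ≤ x → v * y + 6 ≤ u * x := by
    intro u v x y h1 h2 h3
    nlinarith [Nat.mul_le_mul h1 h3]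
  constructor
  · intro h
    by_contra! hcon
    obtain ⟨h7, h56, h34, h342⟩ := hcon
    by_cases ha2 : a ≤ 2
    · have h2 : ∀ x, x ∣ a → x ∣ 2 := fun x hx =>
        hx.trans (by interval_cases a <;> decide)
      rw [hc2 (h2 c (hcb.trans hba)), Nat.gcd_eq_left (h2 a dvd_rfl), Nat.gcd_eq_left (h2 b hba),
        Nat.gcd_eq_left (h2 c (hcb.trans hba))] at h
      omega
    · have hb6 : b ≤ 2 := by
        by_contra hb3
        omega
      have hc1 : c = 1 := by
        have hcle : c ≤ 2 := (Nat.le_of_dvd hb hcb).trans hb6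
        by_contra hc1
        have hble := Nat.le_of_dvd hb hcb
        by_cases h5 : 5 ≤ a
        · have := h56 h5 (by omega)
          omega
        · exact h342 (by omega) (by omega) (by omega) (by omega)
      have hQ1 := hc hc1
      subst hc1 hQ1
      have hQ'1 : Q' = 1 := by omega
      subst hQ'1
      have ha6 : a < 7 := h7
      interval_cases a <;> interval_cases b <;> simp_all +decide
  · rintro (h | ⟨h1, h2, h3⟩ | ⟨h1, h2, h3⟩ | ⟨h1, h2, rfl, rfl⟩)
    · have h0 : Nat.gcd a 2 + 6 ≤ a := by
        rcases (Nat.dvd_prime Nat.prime_two).1 (Nat.gcd_dvd_right a 2) with h2 | h2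
        · omega
        · have := Nat.gcd_dvd_left a 2
          rw [h2] at this ⊢
          omega
      exact grow _ _ _ _ (grow _ _ _ _ (grow _ _ _ _ h0 (gpos b) (gle b hb)) (gpos c) (gle c hc0))
        hQ' hQ
    · refine grow _ _ _ _ (grow _ _ _ _ ?_ (gpos c) (gle c hc0)) hQ' hQ
      have hb6 : b < 7 := lt_of_le_of_lt (Nat.le_of_dvd ha hba) (by omega)
      interval_cases a <;> interval_cases b <;> simp_all +decide
    · refine grow _ _ _ _ (grow _ _ _ _ ?_ (gpos c) (gle c hc0)) hQ' hQ
      have hb6 : b < 7 := lt_of_le_of_lt (Nat.le_of_dvd ha hba) (by omega)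
      interval_cases a <;> interval_cases b <;> simp_all +decide
    · refine grow _ _ _ _ ?_ hQ' hQ
      interval_cases a <;> simp_all +decide

end Counting

lemma gcd_lt_gcd_iff {N A B : ℕ} (hN : 0 < N) (h : B ∣ A) :
    Nat.gcd N A > Nat.gcd N B ↔ ¬ Nat.gcd N A ∣ B := by
  have h1 : Nat.gcd N B ∣ Nat.gcd N A := Nat.gcd_dvd_gcd_of_dvd_right N h
  rw [gt_iff_lt, ← not_le, not_iff_not]
  refine ⟨fun h2 => ?_, fun h2 => ?_⟩
  · rw [Nat.le_antisymm h2 (Nat.le_of_dvd (Nat.gcd_pos_of_pos_left _ hN) h1)]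
    exact Nat.gcd_dvd_right _ _
  · exact Nat.le_of_dvd (Nat.gcd_pos_of_pos_left _ hN) (Nat.dvd_gcd (Nat.gcd_dvd_left _ _) h2)

lemma three_le_iff_not_dvd_two {m : ℕ} (hm : 0 < m) : m ≥ 3 ↔ ¬ m ∣ 2 := by
  refine ⟨fun h h2 => ?_, fun h => ?_⟩
  · have := Nat.le_of_dvd two_pos h2
    omega
  · by_contra h3
    interval_cases m <;> simp_all +decide

/-! ### Characters with values in F and its extensions. -/

section Characters

variable {F H : Type*} [Field F] [Fintype F] [CommGroup H] {r : ℕ} {n : Fin r → ℕ}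

lemma exists_three_characters_iff (hn_dvd : ∀ i j, i ≤ j → n i ∣ n j)
    (e : Additive H ≃+ ((i : Fin r) → ZMod (n i))) [Finite H] {q : ℕ} (hq : Fintype.card F = q)
    (a b c : ℕ) (ha : a = Nat.gcd (factorFromTop n 0) (q - 1))
    (hb : b = Nat.gcd (factorFromTop n 1) (q - 1)) (hc : c = Nat.gcd (factorFromTop n 2) (q - 1)) :
    (∃ χ : Fin 3 → H →* Fˣ, Function.Injective χ ∧ ∀ i j, χ i ≠ (χ j)⁻¹) ↔
      7 ≤ a ∨ (5 ≤ a ∧ a ≤ 6 ∧ 2 ≤ b) ∨ (3 ≤ a ∧ a ≤ 4 ∧ 3 ≤ b) ∨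
        (3 ≤ a ∧ a ≤ 4 ∧ b = 2 ∧ c = 2) := by
  classical
  have hU : Nat.card Fˣ = q - 1 := by
    rw [Nat.card_eq_fintype_card, Fintype.card_units, hq]
  have hq1 : 0 < q - 1 := by
    rw [← hU]
    exact Nat.card_pos
  have : Finite (H →* Fˣ) := DFunLike.finite _
  have hcard : Nat.card (H →* Fˣ) = ∏ i, Nat.gcd (n i) (q - 1) := by
    have := card_characters (U := Fˣ) e 0
    rw [Nat.card_congr (Equiv.subtypeUnivEquiv fun χ => pow_zero χ)] at this
    rw [this, hU]
    exact Finset.prod_congr rfl fun i _ => by rw [Nat.gcd_zero_right, Nat.gcd_comm]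
  have hcard2 : Nat.card {χ : H →* Fˣ // χ ^ 2 = 1} =
      ∏ i, Nat.gcd (Nat.gcd (n i) (q - 1)) 2 := by
    rw [card_characters (U := Fˣ) e 2, hU]
    exact Finset.prod_congr rfl fun i _ => by
      rw [Nat.gcd_left_comm, Nat.gcd_assoc]
  have hdvd : ∀ {k l : ℕ}, k ≤ l →
      Nat.gcd (factorFromTop n l) (q - 1) ∣ Nat.gcd (factorFromTop n k) (q - 1) := fun hkl =>
    Nat.gcd_dvd_gcd_of_dvd_left _ (factorFromTop_dvd hn_dvd hkl)
  refine (exists_three_iff_card (X := H →* Fˣ)).trans ?_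
  rw [hcard, hcard2,
    prod_eq_prod_factorFromTop (fun x => Nat.gcd x (q - 1)) (by simp),
    prod_eq_prod_factorFromTop (fun x => Nat.gcd (Nat.gcd x (q - 1)) 2) (by simp)]
  subst ha hb hc
  refine gcd_two_prod_add_six_le_iff (Nat.gcd_pos_of_pos_right _ hq1) (hdvd (Nat.zero_le 1))
    (hdvd one_le_two) ?_ ?_ ?_ ?_
  · exact Finset.prod_pos fun k _ => Nat.gcd_pos_of_pos_right _ two_pos
  · exact Finset.prod_le_prod' fun k _ => Nat.gcd_le_left _ (Nat.gcd_pos_of_pos_right _ hq1)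
  · intro h1
    exact Finset.prod_eq_one fun k _ => Nat.dvd_one.1
      ((hdvd (Nat.le_add_right_of_le (Nat.le_succ 2))).trans h1.dvd)
  · intro h2
    exact Finset.prod_congr rfl fun k _ => (Nat.gcd_eq_left ((hdvd (Nat.le_add_right_of_le (Nat.le_succ 2))).trans h2)).symm

lemma exists_character_orderOf_extension (e : Additive H ≃+ ((i : Fin r) → ZMod (n i)))
    (K : Type*) [Field K] [Algebra F K] [Module.Finite F K] :
    ∃ (χ : H →* Kˣ) (h : H), orderOf (χ h) =
      Nat.gcd (factorFromTop n 0) (Fintype.card F ^ Module.finrank F K - 1) := by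
  classical
  have : Finite K := Module.finite_of_finite F
  have := Fintype.ofFinite K
  obtain ⟨χ, h, hχ⟩ := exists_character_orderOf (U := Kˣ) e
  refine ⟨χ, h, ?_⟩
  rw [hχ, Nat.card_eq_fintype_card, Fintype.card_units, ← Module.card_eq_pow_finrank]

lemma exists_character_ne_inv (e : Additive H ≃+ ((i : Fin r) → ZMod (n i)))
    (h : ¬ Nat.gcd (factorFromTop n 0) (Fintype.card F - 1) ∣ 2) :
    ∃ ψ : H →* Fˣ, ψ ≠ ψ⁻¹ := by
  obtain ⟨ψ, g, hψ⟩ := exists_character_orderOf_extension (F := F) e F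
  rw [Module.finrank_self, pow_one] at hψ
  refine ⟨ψ, fun heq => h ?_⟩
  rw [← hψ]
  refine orderOf_dvd_of_pow_eq_one ?_
  have := DFunLike.congr_fun heq g
  rw [sq]
  exact eq_inv_iff_mul_eq_one.1 this

end Characters

/-! ### The equivalence. -/

theorem theorem4p2 {F G : Type*} [Field F] [Fintype F] [Group G] [Fintype G]
    (q : ℕ) (hq : Fintype.card F = q) (hG : Nat.Coprime (Fintype.card G) q)
    (r : ℕ) (n : Fin r → ℕ) (hn_one : ∀ i, 1 < n i) (hn_dvd : ∀ i j, i ≤ j → n i ∣ n j)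
    (hn : Nonempty (Additive (Abelianization G) ≃+ ((i : Fin r) → ZMod (n i)))) :
    (∃ C : Ideal (MonoidAlgebra F G), C.IsTwoSided ∧
        Module.finrank F (codeHull (C.restrictScalars F)) = 3) ↔
      (7 ≤ Nat.gcd (factorFromTop n 0) (q - 1)) ∨
      (5 ≤ Nat.gcd (factorFromTop n 0) (q - 1) ∧ Nat.gcd (factorFromTop n 0) (q - 1) ≤ 6 ∧
        2 ≤ Nat.gcd (factorFromTop n 1) (q - 1)) ∨
      (3 ≤ Nat.gcd (factorFromTop n 0) (q - 1) ∧ Nat.gcd (factorFromTop n 0) (q - 1) ≤ 4 ∧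
        3 ≤ Nat.gcd (factorFromTop n 1) (q - 1)) ∨
      (3 ≤ Nat.gcd (factorFromTop n 0) (q - 1) ∧ Nat.gcd (factorFromTop n 0) (q - 1) ≤ 4 ∧
        Nat.gcd (factorFromTop n 1) (q - 1) = 2 ∧ Nat.gcd (factorFromTop n 2) (q - 1) = 2) ∨
      (Nat.gcd (factorFromTop n 0) (q ^ 2 - 1) > Nat.gcd (factorFromTop n 0) (q - 1) ∧
        Nat.gcd (factorFromTop n 0) (q - 1) ≥ 3 ∧
        Nat.gcd (factorFromTop n 0) (q ^ 2 - 1) > Nat.gcd (factorFromTop n 0) (q + 1)) ∨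
      (Nat.gcd (factorFromTop n 0) (q ^ 3 - 1) > Nat.gcd (factorFromTop n 0) (q - 1)) := by
  obtain ⟨e⟩ := hn
  have hN : 0 < factorFromTop n 0 := by
    rw [factorFromTop]
    split_ifs
    · exact zero_lt_one.trans (hn_one _)
    · exact one_pos
  have hpow : ∀ k, q - 1 ∣ q ^ k - 1 := fun k => by
    simpa using Nat.sub_dvd_pow_sub_pow q 1 k
  have hsq : q + 1 ∣ q ^ 2 - 1 := ⟨q - 1, by simpa using Nat.sq_sub_sq q 1⟩
  rw [gcd_lt_gcd_iff hN (hpow 2), gcd_lt_gcd_iff hN hsq, gcd_lt_gcd_iff hN (hpow 3),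
    three_le_iff_not_dvd_two (Nat.gcd_pos_of_pos_left _ hN)]
  have hchar := exists_three_characters_iff (F := F) hn_dvd e hq _ _ _ rfl rfl rfl
  -- This is the hypothesis of Maschke's theorem, which makes F[G] semisimple.
  have hne : NeZero (Nat.card G : F) := by
    refine ⟨fun h0 => ?_⟩
    rw [Nat.card_eq_fintype_card, ringChar.spec] at h0
    have h1 : ringChar F ∣ q := by
      rw [← ringChar.spec, ← hq, FiniteField.cast_card_eq_zero]
    exact CharP.ringChar_ne_one (Nat.eq_one_of_dvd_coprimes hG h0 h1)
  rw [show ∀ A B C D E : Prop, (A ∨ B ∨ C ∨ D ∨ E) ↔ ((A ∨ B ∨ C ∨ D) ∨ E) by tauto, ← hchar]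
  subst hq
  constructor
  · rintro ⟨C, _, hC⟩
    exact necessary_of_hull C hC (pow_factorFromTop hn_dvd e)
  · have : Fact (ringChar F).Prime := ⟨CharP.char_is_prime F _⟩
    rintro (⟨χ, h1, h2⟩ | ⟨h1, h2, h3⟩ | h)
    · exact exists_hull_of_linear_characters h1 h2
    · have hK := FiniteField.finrank_extension F (ringChar F) 2
      obtain ⟨χ, g, hχ⟩ := exists_character_orderOf_extension (F := F) e
        (FiniteField.Extension F (ringChar F) 2)
      obtain ⟨ψ, hψ⟩ := exists_character_ne_inv e h2
      rw [hK] at hχ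
      rw [← hχ] at h1 h3
      exact exists_hull_of_quadratic_character hK χ g (hχ ▸ Nat.gcd_dvd_right _ _) h1 h3 ψ hψ
    · have hK := FiniteField.finrank_extension F (ringChar F) 3
      obtain ⟨χ, g, hχ⟩ := exists_character_orderOf_extension (F := F) e
        (FiniteField.Extension F (ringChar F) 3)
      rw [hK] at hχ
      rw [← hχ] at h
      exact exists_hull_of_cubic_character hK χ g (hχ ▸ Nat.gcd_dvd_right _ _) h
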